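/- A (real) Banach lattice is a real Banach space $(E,\|\cdot\|)$ that is also a vector lattice such that $|x|\le |y|$ implies $\|x\|\le\|y\|$; write $E_+=\{x\in E: x\ge 0\}$. Let $E$ and $F$ be Banach lattices and let $T:E\to F$ be a continuous linear operator. A net $(x_\alpha)$ in $E$ is *uaw-convergent* to $x\in E$, written $x_\alpha\xrightarrow{uaw}x$, if $|x_\alpha-x|\wedge u\to 0$ weakly for every $u\in E_+$. The operator $T$ is *uaw-Dunford–Pettis* if $\|Tx_n\|\to 0$ for every norm bounded sequence $(x_n)$ in $E$ with $x_n\xrightarrow{uaw}0$; it is *Dunford–Pettis* if $\|Tx_n\|\to 0$ for every weakly null sequence $(x_n)$ in $E$; it is *positive* if $T(E_+)\subseteq F_+$. The lattice operations of $E$ are *weakly sequentially continuous* if $x_n\to 0$ weakly implies $|x_n|\to 0$ weakly, for sequences in $E$. An element $e>0$ of a vector lattice is *discrete* if every $y$ with $|y|\le e$ is a scalar multiple of $e$, and a vector lattice is *discrete* if for every $x>0$ there is a discrete element $e$ with $e\le x$. A Banach lattice has *order continuous norm* if $x_\alpha\downarrow 0$ implies $\|x_\alpha\|\to 0$ for every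 net $(x_\alpha)$ in it. **Theorem.** If $T:E\to F$ is uaw-Dunford–Pettis, then $T$ is Dunford–Pettis provided that at least one of the following holds: 1. the lattice operations of $E$ are weakly sequentially continuous; 2. $E$ is discrete with order continuous norm; 3. $T$ is positive and $F$ is discrete with order continuous norm. -/

import Mathlib

open Filter Topology

/- A (real) Banach lattice `E` is given throughout by the instances
`[NormedAddCommGroup E] [NormedSpace ℝ E] [CompleteSpace E]` (a real Banach space),
`[Lattice E] [IsOrderedAddMonoid E] [IsOrderedModule ℝ E]` (a vector lattice) and
`[HasSolidNorm E]` (`|x| ≤ |y|` implies `‖x‖ ≤ ‖y‖`). -/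

/-- `x → a` along `l` in the weak topology of `E`. -/
def WeakTendsto {E : Type*} [NormedAddCommGroup E] [NormedSpace ℝ E]
    {ι : Type*} (x : ι → E) (l : Filter ι) (a : E) : Prop :=
  Tendsto (fun i => toWeakSpace ℝ E (x i)) l (𝓝 (toWeakSpace ℝ E a))

/-- Unbounded absolutely weak convergence: `|x i - a| ⊓ u → 0` weakly for each `u ≥ 0`. -/
def UawTendsto {E : Type*} [NormedAddCommGroup E] [NormedSpace ℝ E] [Lattice E]
    {ι : Type*} (x : ι → E) (l : Filter ι) (a : E) : Prop :=
  ∀ u : E, 0 ≤ u → WeakTendsto (fun i => |x i - a| ⊓ u) l 0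

/-- A Dunford–Pettis operator maps weakly null sequences to norm null sequences. -/
def IsDunfordPettis {X Y : Type*} [NormedAddCommGroup X] [NormedSpace ℝ X]
    [NormedAddCommGroup Y] [NormedSpace ℝ Y] (T : X →L[ℝ] Y) : Prop :=
  ∀ x : ℕ → X, WeakTendsto x atTop 0 → Tendsto (fun n => ‖T (x n)‖) atTop (𝓝 0)

/-- A uaw-Dunford–Pettis operator maps norm bounded uaw-null sequences to norm null sequences. -/
def IsUawDunfordPettis {E X : Type*} [NormedAddCommGroup E] [NormedSpace ℝ E] [Lattice E]
    [NormedAddCommGroup X] [NormedSpace ℝ X] (T : E →L[ℝ] X) : Prop :=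
  ∀ x : ℕ → E, (∃ C : ℝ, ∀ n, ‖x n‖ ≤ C) → UawTendsto x atTop 0 →
    Tendsto (fun n => ‖T (x n)‖) atTop (𝓝 0)

/-- The lattice operations of `E` are weakly sequentially continuous:
`x n → 0` weakly implies `|x n| → 0` weakly. -/
def WeaklySeqContinuousLatticeOps (E : Type*) [NormedAddCommGroup E] [NormedSpace ℝ E]
    [Lattice E] : Prop :=
  ∀ x : ℕ → E, WeakTendsto x atTop 0 → WeakTendsto (fun n => |x n|) atTop 0

/-- A discrete element (atom): `e > 0`, and each `y` with `|y| ≤ e` is a scalar multiple of `e`.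
By scaling, this says that the order ideal generated by `e` is the line spanned by `e`. -/
def IsDiscreteElement {E : Type*} [AddCommGroup E] [Module ℝ E] [Lattice E] (e : E) : Prop :=
  0 < e ∧ ∀ y : E, |y| ≤ e → ∃ c : ℝ, y = c • e

/-- A vector lattice is discrete (atomic) if each `x > 0` dominates a discrete element. -/
def IsDiscreteVectorLattice (E : Type*) [AddCommGroup E] [Module ℝ E] [Lattice E] : Prop :=
  ∀ x : E, 0 < x → ∃ e : E, IsDiscreteElement e ∧ e ≤ x

/-- The norm of `E` is order continuous: each net decreasing to `0` in order converges to `0` in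
norm. Index sets in the universe of `E` suffice: a decreasing net, over any directed set, and
the downward directed subset of `E` formed by its values have the same infimum, and the norms
along the net decrease to the infimum of the norms over that set. -/
def HasOrderContinuousNorm.{u} (E : Type u) [NormedAddCommGroup E] [Lattice E] : Prop :=
  ∀ (ι : Type u) [Preorder ι] [IsDirectedOrder ι] [Nonempty ι] (x : ι → E),
    Antitone x → IsGLB (Set.range x) 0 → Tendsto (fun i => ‖x i‖) atTop (𝓝 0)

/-!
A weakly null sequence `x` is norm bounded, so the uaw-Dunford–Pettis property applies to it as soon
as `|x n| ⊓ u → 0` weakly for each `u ≥ 0`.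

If the lattice operations are weakly sequentially continuous, this holds because
`0 ≤ |x n| ⊓ u ≤ |x n|`, and because weak convergence to zero is tested by positive functionals
(`weakTendsto_zero_iff_forall_nonneg`, by the Riesz–Kantorovich decomposition of a functional).

If `E` is discrete with order continuous norm, then even `‖|x n| ⊓ u‖ → 0`
(`WeakTendsto.tendsto_norm_abs_inf`). For a discrete element `e` in place of `u` the truncation is
controlled by the coordinate functional of `e`, which is a lattice homomorphism; this passes to
finite sums of discrete elements, and these approximate `u` in norm from below.

If instead `T` is positive and `F` is discrete with order continuous norm, the sequence `x` need not
be uaw-null, but the same fact can be used in `F`. A disjoint sequence is uaw-null, so `T` sends norm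
bounded disjoint sequences to norm null ones. The usual disjointification
(`exists_disjoint_posPart_sub`) turns this into the following: for each `ε > 0` there is `u ≥ 0` with
`‖T (|x n| - u)⁺‖ < ε` for all `n`. Now `|T (x n)| ≤ |T (x n)| ⊓ T u + T (|x n| - u)⁺`, where the
first summand tends to zero in norm because `T (x n) → 0` weakly in `F`.
-/

/-! ### Vector lattices -/

section VectorLattice

variable {E : Type*} [AddCommGroup E] [Lattice E] [IsOrderedAddMonoid E]

lemma inf_add_le_inf_add_inf {a b c : E} (ha : 0 ≤ a) (hb : 0 ≤ b) (hc : 0 ≤ c) :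
    a ⊓ (b + c) ≤ a ⊓ b + a ⊓ c := by
  rw [inf_add, add_inf, add_inf]
  refine le_inf (le_inf ?_ ?_) (le_inf ?_ inf_le_right)
  · exact inf_le_left.trans (le_add_of_nonneg_left ha)
  · exact inf_le_left.trans (le_add_of_nonneg_right hc)
  · exact inf_le_left.trans (le_add_of_nonneg_left hb)

/-- The Riesz decomposition property. -/
lemma exists_add_eq_of_le_add {a b y : E} (ha : 0 ≤ a) (hy : 0 ≤ y) (h : y ≤ a + b) (hb : 0 ≤ b) :
    ∃ y₁ y₂, 0 ≤ y₁ ∧ y₁ ≤ a ∧ 0 ≤ y₂ ∧ y₂ ≤ b ∧ y₁ + y₂ = y := by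
  refine ⟨y ⊓ a, y - y ⊓ a, le_inf hy ha, inf_le_right, sub_nonneg.2 inf_le_left, ?_, by abel⟩
  rw [sub_inf, sub_self]
  exact sup_le hb (sub_le_iff_le_add'.2 h)

lemma sum_range_le_of_pairwise_inf_eq_zero {w : ℕ → E} {u : E} (hw : ∀ n, 0 ≤ w n)
    (hwu : ∀ n, w n ≤ u) (hd : ∀ m n, m < n → w m ⊓ w n = 0) (N : ℕ) :
    ∑ i ∈ Finset.range N, w i ≤ u := by
  -- a sum of disjoint positive elements is their supremum
  have hS : ∀ M N, M ≤ N → (∑ i ∈ Finset.range M, w i) ⊓ w N = 0 := by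
    intro M N hMN
    induction M with
    | zero => simp [hw N]
    | succ M ih =>
      have h0 : 0 ≤ ∑ i ∈ Finset.range M, w i := Finset.sum_nonneg fun i _ => hw i
      rw [Finset.sum_range_succ]
      refine le_antisymm ?_ (le_inf (add_nonneg h0 (hw M)) (hw N))
      rw [inf_comm]
      refine (inf_add_le_inf_add_inf (hw N) h0 (hw M)).trans ?_
      rw [inf_comm, ih (by omega), inf_comm, hd M N (by omega), add_zero]
  induction N with
  | zero => simpa using (hw 0).trans (hwu 0)
  | succ N ih =>
    rw [Finset.sum_range_succ, ← inf_add_sup, hS N N le_rfl, zero_add]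
    exact sup_le ih (hwu N)

end VectorLattice

/-! ### Weak convergence -/

section WeakConvergence

variable {X : Type*} [NormedAddCommGroup X] [NormedSpace ℝ X] {ι : Type*} {l : Filter ι}

lemma weakTendsto_iff_forall_dual {x : ι → X} {a : X} :
    WeakTendsto x l a ↔ ∀ φ : X →L[ℝ] ℝ, Tendsto (fun i => φ (x i)) l (𝓝 (φ a)) := by
  have hinj : Function.Injective (topDualPairing ℝ X).flip := by
    intro x y h
    by_contra hne
    obtain ⟨φ, hφ⟩ := SeparatingDual.exists_separating_of_ne (R := ℝ) hne
    exact hφ (LinearMap.congr_fun h φ)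
  exact WeakBilin.tendsto_iff_forall_eval_tendsto _ hinj

lemma weakTendsto_zero_iff_forall_dual {x : ι → X} :
    WeakTendsto x l 0 ↔ ∀ φ : X →L[ℝ] ℝ, Tendsto (fun i => φ (x i)) l (𝓝 0) := by
  simp [weakTendsto_iff_forall_dual]

lemma WeakTendsto.exists_norm_le {x : ℕ → X} {a : X} (hx : WeakTendsto x atTop a) :
    ∃ C : ℝ, ∀ n, ‖x n‖ ≤ C := by
  obtain ⟨C, hC⟩ := banach_steinhaus (g := fun n => NormedSpace.inclusionInDoubleDual ℝ X (x n))
    fun φ => by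
      obtain ⟨K, hK⟩ := (weakTendsto_iff_forall_dual.1 hx φ).norm.bddAbove_range
      exact ⟨K, fun n => hK ⟨n, rfl⟩⟩
  refine ⟨C, fun n => ?_⟩
  exact ((NormedSpace.inclusionInDoubleDualLi ℝ (E := X)).norm_map (x n)).symm.trans_le (hC n)

lemma WeakTendsto.map {Y : Type*} [NormedAddCommGroup Y] [NormedSpace ℝ Y] {x : ι → X} {a : X}
    (hx : WeakTendsto x l a) (T : X →L[ℝ] Y) : WeakTendsto (fun i => T (x i)) l (T a) :=
  weakTendsto_iff_forall_dual.2 fun φ => weakTendsto_iff_forall_dual.1 hx (φ.comp T)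

lemma weakTendsto_zero_of_tendsto_norm {x : ι → X} (hx : Tendsto (fun i => ‖x i‖) l (𝓝 0)) :
    WeakTendsto x l 0 :=
  weakTendsto_zero_iff_forall_dual.2 fun φ => by
    have h := (φ.continuous.tendsto 0).comp (tendsto_zero_iff_norm_tendsto_zero.2 hx)
    rwa [map_zero] at h

end WeakConvergence

/-! ### Positive functionals on normed lattices -/

section NormedLattice

variable {E : Type*} [NormedAddCommGroup E] [Lattice E] [IsOrderedAddMonoid E] [HasSolidNorm E]

lemma norm_le_norm_of_nonneg_of_le {a b : E} (ha : 0 ≤ a) (h : a ≤ b) : ‖a‖ ≤ ‖b‖ :=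
  norm_le_norm_of_abs_le_abs (abs_le_abs_of_nonneg ha h)

lemma norm_posPart_le (a : E) : ‖a⁺‖ ≤ ‖a‖ := by
  rw [← norm_abs_eq_norm a]
  exact norm_le_norm_of_nonneg_of_le (posPart_nonneg a) (sup_le (le_abs_self a) (abs_nonneg a))

lemma norm_negPart_le (a : E) : ‖a⁻‖ ≤ ‖a‖ := by
  simpa using norm_posPart_le (-a)

end NormedLattice

section PositiveFunctionals

variable {E : Type*} [NormedAddCommGroup E] [NormedSpace ℝ E]
  [Lattice E] [IsOrderedAddMonoid E] [HasSolidNorm E]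

/-- A bounded additive function on the positive cone extends to a bounded functional. The
extension `x ↦ p x⁺ - p x⁻` is additive and continuous, hence real-linear. -/
lemma exists_dual_eq_on_nonneg {p : E → ℝ} {C : ℝ}
    (hadd : ∀ x y, 0 ≤ x → 0 ≤ y → p (x + y) = p x + p y)
    (hC : ∀ x, 0 ≤ x → |p x| ≤ C * ‖x‖) :
    ∃ f : E →L[ℝ] ℝ, ∀ x, 0 ≤ x → f x = p x := by
  have hp0 : p 0 = 0 := by simpa using hadd 0 0 le_rfl le_rfl
  have hC0 : ∀ x, |p x⁺| ≤ |C| * ‖x‖ ∧ |p x⁻| ≤ |C| * ‖x‖ := fun x =>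
    ⟨(hC _ (posPart_nonneg x)).trans
        (mul_le_mul (le_abs_self C) (norm_posPart_le x) (norm_nonneg _) (abs_nonneg C)),
      (hC _ (negPart_nonneg x)).trans
        (mul_le_mul (le_abs_self C) (norm_negPart_le x) (norm_nonneg _) (abs_nonneg C))⟩
  let g : E →+ ℝ := AddMonoidHom.mk' (fun x => p x⁺ - p x⁻) <| by
    intro x y
    have hpos := fun z : E => posPart_nonneg z
    have hneg := fun z : E => negPart_nonneg z
    have h : (x + y)⁺ + (x⁻ + y⁻) = (x + y)⁻ + (x⁺ + y⁺) := by
      have h1 := posPart_sub_negPart (x + y)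
      have h2 := posPart_sub_negPart x
      have h3 := posPart_sub_negPart y
      rw [← sub_eq_zero]
      calc _ = ((x + y)⁺ - (x + y)⁻) - (x⁺ - x⁻) - (y⁺ - y⁻) := by abel
        _ = 0 := by rw [h1, h2, h3]; abel
    have h' := congrArg p h
    rw [hadd _ _ (hpos _) (add_nonneg (hneg _) (hneg _)), hadd _ _ (hneg _) (hneg _),
      hadd _ _ (hneg _) (add_nonneg (hpos _) (hpos _)), hadd _ _ (hpos _) (hpos _)] at h'
    linarith
  have hg : Continuous g := by
    refine AddMonoidHomClass.continuous_of_bound g (2 * |C|) fun x => ?_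
    have h1 : ‖g x‖ ≤ |p x⁺| + |p x⁻| := norm_sub_le _ _
    linarith [(hC0 x).1, (hC0 x).2]
  refine ⟨g.toRealLinearMap hg, fun x hx => ?_⟩
  change p x⁺ - p x⁻ = p x
  rw [posPart_of_nonneg hx, negPart_of_nonneg hx, hp0, sub_zero]

open scoped Pointwise in
/-- The Riesz–Kantorovich construction restricted to an ideal `I`, of which only the positive
elements matter: on `E₊`, the functional obtained is the supremum of `φ` over `I ∩ [0, x]`. The ideal
`I = E` gives the positive part of `φ`; the line through a discrete element gives the coordinate
functional of that element. -/
lemma exists_dual_isLUB (φ : E →L[ℝ] ℝ) {I : Set E} (h0 : 0 ∈ I)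
    (hadd : ∀ y ∈ I, ∀ z ∈ I, 0 ≤ y → 0 ≤ z → y + z ∈ I)
    (hsolid : ∀ z ∈ I, ∀ y, 0 ≤ y → y ≤ z → y ∈ I) :
    ∃ f : E →L[ℝ] ℝ, ∀ x, 0 ≤ x → IsLUB (φ '' {y ∈ I | 0 ≤ y ∧ y ≤ x}) (f x) := by
  have hbd : ∀ x, ‖φ‖ * ‖x‖ ∈ upperBounds (φ '' {y ∈ I | 0 ≤ y ∧ y ≤ x}) := by
    rintro x _ ⟨y, ⟨-, hy0, hyx⟩, rfl⟩
    exact (le_abs_self _).trans ((φ.le_opNorm y).trans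
      (mul_le_mul_of_nonneg_left (norm_le_norm_of_nonneg_of_le hy0 hyx) (norm_nonneg _)))
  have hmem0 : ∀ x, 0 ≤ x → (0 : ℝ) ∈ φ '' {y ∈ I | 0 ≤ y ∧ y ≤ x} := fun x hx =>
    ⟨0, ⟨h0, le_rfl, hx⟩, map_zero φ⟩
  have hlub : ∀ x, 0 ≤ x → IsLUB (φ '' {y ∈ I | 0 ≤ y ∧ y ≤ x})
      (sSup (φ '' {y ∈ I | 0 ≤ y ∧ y ≤ x})) := fun x hx =>
    isLUB_csSup ⟨0, hmem0 x hx⟩ ⟨_, hbd x⟩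
  suffices h : ∃ f : E →L[ℝ] ℝ, ∀ x, 0 ≤ x → f x = sSup (φ '' {y ∈ I | 0 ≤ y ∧ y ≤ x}) by
    obtain ⟨f, hf⟩ := h
    exact ⟨f, fun x hx => by rw [hf x hx]; exact hlub x hx⟩
  refine exists_dual_eq_on_nonneg (C := ‖φ‖) ?_ ?_
  · intro a b ha hb
    have hset : φ '' {y ∈ I | 0 ≤ y ∧ y ≤ a + b} =
        φ '' {y ∈ I | 0 ≤ y ∧ y ≤ a} + φ '' {y ∈ I | 0 ≤ y ∧ y ≤ b} := by
      ext t
      constructor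
      · rintro ⟨y, ⟨hyI, hy0, hy⟩, rfl⟩
        obtain ⟨y₁, y₂, h1, h1a, h2, h2b, rfl⟩ := exists_add_eq_of_le_add ha hy0 hy hb
        exact ⟨φ y₁, ⟨y₁, ⟨hsolid _ hyI _ h1 (le_add_of_nonneg_right h2), h1, h1a⟩, rfl⟩,
          φ y₂, ⟨y₂, ⟨hsolid _ hyI _ h2 (le_add_of_nonneg_left h1), h2, h2b⟩, rfl⟩,
          (map_add φ _ _).symm⟩
      · rintro ⟨_, ⟨y₁, ⟨h1I, h1, h1a⟩, rfl⟩, _, ⟨y₂, ⟨h2I, h2, h2b⟩, rfl⟩, rfl⟩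
        exact ⟨y₁ + y₂, ⟨hadd _ h1I _ h2I h1 h2, add_nonneg h1 h2, add_le_add h1a h2b⟩,
          map_add φ _ _⟩
    exact (hlub (a + b) (add_nonneg ha hb)).unique (hset ▸ (hlub a ha).add (hlub b hb))
  · intro x hx
    rw [abs_of_nonneg ((hlub x hx).1 (hmem0 x hx))]
    exact (hlub x hx).2 (hbd x)

/-- Positive functionals determine weak convergence to zero, since every functional is a
difference of two positive ones. -/
lemma weakTendsto_zero_iff_forall_nonneg {ι : Type*} {l : Filter ι} {x : ι → E} :
    WeakTendsto x l 0 ↔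
      ∀ f : E →L[ℝ] ℝ, (∀ y, 0 ≤ y → 0 ≤ f y) → Tendsto (fun i => f (x i)) l (𝓝 0) := by
  rw [weakTendsto_zero_iff_forall_dual]
  refine ⟨fun h f _ => h f, fun h φ => ?_⟩
  obtain ⟨f, hf⟩ := exists_dual_isLUB φ (Set.mem_univ 0) (fun _ _ _ _ _ _ => Set.mem_univ _)
    (fun _ _ _ _ _ => Set.mem_univ _)
  have h1 := h f fun y hy => (hf y hy).1 ⟨0, ⟨Set.mem_univ _, le_rfl, hy⟩, map_zero φ⟩
  have h2 := h (f - φ) fun y hy =>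
    sub_nonneg.2 ((hf y hy).1 ⟨y, ⟨Set.mem_univ _, hy, le_rfl⟩, rfl⟩)
  simpa using h1.sub h2

lemma WeakTendsto.of_nonneg_of_le {ι : Type*} {l : Filter ι} {x y : ι → E}
    (hy : WeakTendsto y l 0) (hx : ∀ i, 0 ≤ x i) (hxy : ∀ i, x i ≤ y i) : WeakTendsto x l 0 := by
  rw [weakTendsto_zero_iff_forall_nonneg] at hy ⊢
  refine fun f hf => squeeze_zero (fun i => hf _ (hx i)) (fun i => ?_) (hy f hf)
  simpa using hf _ (sub_nonneg.2 (hxy i))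

lemma uawTendsto_zero_of_pairwise_inf_eq_zero {z : ℕ → E} (hz : ∀ n, 0 ≤ z n)
    (hd : ∀ m n, m < n → z m ⊓ z n = 0) : UawTendsto z atTop 0 := by
  intro u hu
  rw [weakTendsto_zero_iff_forall_nonneg]
  intro f hf
  have hw : ∀ n, 0 ≤ z n ⊓ u := fun n => le_inf (hz n) hu
  have hd' : ∀ m n, m < n → (z m ⊓ u) ⊓ (z n ⊓ u) = 0 := fun m n hmn =>
    le_antisymm ((inf_le_inf inf_le_left inf_le_left).trans (hd m n hmn).le)
      (le_inf (hw m) (hw n))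
  -- the partial sums of `f (z n ⊓ u)` are at most `f u`, so its terms tend to zero
  have hs : Summable fun n => f (z n ⊓ u) := by
    refine summable_of_sum_range_le (c := f u) (fun n => hf _ (hw n)) fun N => ?_
    rw [← map_sum]
    simpa using hf _ (sub_nonneg.2
      (sum_range_le_of_pairwise_inf_eq_zero hw (fun n => inf_le_right) hd' N))
  simpa [abs_of_nonneg (hz _)] using hs.tendsto_atTop_zero

end PositiveFunctionals

/-! ### Discrete elements and order continuous norms -/

section Discrete

/-- The positive cone of the ideal generated by the discrete elements: the finite sums of
discrete elements. -/
def discreteCone (E : Type*) [AddCommGroup E] [Module ℝ E] [Lattice E] : AddSubmonoid E :=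
  AddSubmonoid.closure {e | IsDiscreteElement e}

section VectorLattice

variable {E : Type*} [AddCommGroup E] [Module ℝ E] [Lattice E] [IsOrderedAddMonoid E]

lemma nonneg_of_mem_discreteCone {s : E} (hs : s ∈ discreteCone E) : 0 ≤ s := by
  induction hs using AddSubmonoid.closure_induction with
  | mem e he => exact he.1.le
  | zero => exact le_rfl
  | add s t _ _ hs ht => exact add_nonneg hs ht

lemma IsDiscreteElement.of_pos_of_le {e y : E} (he : IsDiscreteElement e) (hy : 0 < y)
    (hye : y ≤ e) : IsDiscreteElement y :=
  ⟨hy, fun z hz => by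
    obtain ⟨c, rfl⟩ := he.2 y (by rwa [abs_of_nonneg hy.le])
    obtain ⟨d, rfl⟩ := he.2 z (hz.trans hye)
    have hc : c ≠ 0 := by
      rintro rfl
      simp at hy
    exact ⟨d / c, by rw [smul_smul, div_mul_cancel₀ _ hc]⟩⟩

lemma mem_discreteCone_of_le {s : E} (hs : s ∈ discreteCone E) :
    ∀ y, 0 ≤ y → y ≤ s → y ∈ discreteCone E := by
  induction hs using AddSubmonoid.closure_induction with
  | mem e he =>
    intro y hy hye
    rcases hy.eq_or_lt with rfl | hpos
    · exact zero_mem _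
    · exact AddSubmonoid.subset_closure (he.of_pos_of_le hpos hye)
  | zero =>
    intro y hy hy0
    rw [le_antisymm hy0 hy]
    exact zero_mem _
  | add s t hs ht ihs iht =>
    intro y hy hyst
    obtain ⟨y₁, y₂, h1, h1s, h2, h2t, rfl⟩ := exists_add_eq_of_le_add
      (nonneg_of_mem_discreteCone hs) hy hyst (nonneg_of_mem_discreteCone ht)
    exact add_mem (ihs _ h1 h1s) (iht _ h2 h2t)

end VectorLattice

variable {E : Type*} [NormedAddCommGroup E] [NormedSpace ℝ E]
  [Lattice E] [IsOrderedAddMonoid E] [IsOrderedModule ℝ E] [HasSolidNorm E]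

/-- The coordinate functional `f` of a discrete element `e` is a lattice homomorphism, whence
`f |x| = |f x|`; it is normalised so that it takes the value `‖e‖` at `e`. -/
lemma IsDiscreteElement.exists_dual_norm_abs_inf_le {e : E} (he : IsDiscreteElement e) :
    ∃ f : E →L[ℝ] ℝ, ∀ x, ‖|x| ⊓ e‖ ≤ |f x| := by
  obtain ⟨φ, -, hφe⟩ := exists_dual_vector'' ℝ e
  replace hφe : φ e = ‖e‖ := by simpa using hφe
  obtain ⟨f, hf⟩ := exists_dual_isLUB φ (I := {y : E | ∃ c : ℝ, y = c • e}) ⟨0, by simp⟩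
    (by
      rintro _ ⟨c, rfl⟩ _ ⟨d, rfl⟩ _ _
      exact ⟨c + d, (add_smul c d e).symm⟩)
    (by
      rintro _ ⟨c, rfl⟩ y hy hyc
      -- `y ≤ c • e ≤ n • e`, and positive elements below `n • e` are multiples of `e`
      obtain ⟨n, hn⟩ := exists_nat_gt (max c 1)
      have hn0 : (0 : ℝ) < n := zero_lt_one.trans ((le_max_right c 1).trans_lt hn)
      have hyn : y ≤ (n : ℝ) • e :=
        hyc.trans (smul_le_smul_of_nonneg_right ((le_max_left c 1).trans hn.le) he.1.le)
      obtain ⟨d, hd⟩ := he.2 ((n : ℝ)⁻¹ • y) (by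
        rw [abs_of_nonneg (smul_nonneg (inv_nonneg.2 hn0.le) hy)]
        simpa [smul_smul, hn0.ne'] using
          smul_le_smul_of_nonneg_left hyn (inv_nonneg.2 hn0.le))
      exact ⟨n * d, by rw [mul_smul, ← hd, smul_smul, mul_inv_cancel₀ hn0.ne', one_smul]⟩)
  have hf0 : ∀ x, 0 ≤ x → 0 ≤ f x := fun x hx =>
    (hf x hx).1 ⟨0, ⟨⟨0, by simp⟩, le_rfl, hx⟩, map_zero φ⟩
  -- where `f` is positive, `x` dominates a positive multiple of `e`
  have hpos : ∀ x, 0 ≤ x → 0 < f x → ∃ c : ℝ, 0 < c ∧ c • e ≤ x := by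
    intro x hx hfx
    obtain ⟨_, ⟨_, ⟨⟨c, rfl⟩, -, hcx⟩, rfl⟩, hc⟩ := (lt_isLUB_iff (hf x hx)).1 hfx
    rw [map_smul, hφe, smul_eq_mul] at hc
    exact ⟨c, pos_of_mul_pos_left hc (norm_nonneg e), hcx⟩
  have hdisj : ∀ x, f x⁺ = 0 ∨ f x⁻ = 0 := by
    intro x
    by_contra! h
    obtain ⟨c, hc, hcx⟩ := hpos _ (posPart_nonneg x)
      (lt_of_le_of_ne (hf0 _ (posPart_nonneg x)) h.1.symm)
    obtain ⟨d, hd, hdx⟩ := hpos _ (negPart_nonneg x)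
      (lt_of_le_of_ne (hf0 _ (negPart_nonneg x)) h.2.symm)
    have hle : min c d • e ≤ 0 := by
      rw [← posPart_inf_negPart_eq_zero x]
      exact le_inf ((smul_le_smul_of_nonneg_right (min_le_left c d) he.1.le).trans hcx)
        ((smul_le_smul_of_nonneg_right (min_le_right c d) he.1.le).trans hdx)
    exact smul_ne_zero (lt_min hc hd).ne' he.1.ne'
      (le_antisymm hle (smul_nonneg (lt_min hc hd).le he.1.le))
  have habs : ∀ x, f |x| = |f x| := by
    intro x
    rw [← posPart_add_negPart x]
    conv_rhs => rw [← posPart_sub_negPart x]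
    rw [map_add, map_sub]
    rcases hdisj x with h | h
    · rw [h, zero_add, zero_sub, abs_neg, abs_of_nonneg (hf0 _ (negPart_nonneg x))]
    · rw [h, add_zero, sub_zero, abs_of_nonneg (hf0 _ (posPart_nonneg x))]
  refine ⟨f, fun x => ?_⟩
  have hz : 0 ≤ |x| ⊓ e := le_inf (abs_nonneg x) he.1.le
  obtain ⟨c, hc⟩ := he.2 (|x| ⊓ e) (by rw [abs_of_nonneg hz]; exact inf_le_right)
  have hnorm : ‖|x| ⊓ e‖ ≤ φ (|x| ⊓ e) := by
    rcases le_total 0 c with h | h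
    · rw [hc, norm_smul, map_smul, hφe, Real.norm_of_nonneg h, smul_eq_mul]
    · have h0 : |x| ⊓ e = 0 :=
        le_antisymm (hc ▸ smul_nonpos_of_nonpos_of_nonneg h he.1.le) hz
      simp [h0]
  rw [← habs]
  exact hnorm.trans ((hf _ (abs_nonneg x)).1 ⟨_, ⟨⟨c, hc⟩, hz, inf_le_left⟩, rfl⟩)

lemma tendsto_norm_abs_inf_of_mem_discreteCone {ι : Type*} {l : Filter ι} {x : ι → E}
    (hx : WeakTendsto x l 0) {s : E} (hs : s ∈ discreteCone E) :
    Tendsto (fun i => ‖|x i| ⊓ s‖) l (𝓝 0) := by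
  induction hs using AddSubmonoid.closure_induction with
  | mem e he =>
    obtain ⟨f, hf⟩ := IsDiscreteElement.exists_dual_norm_abs_inf_le he
    have h := (weakTendsto_zero_iff_forall_dual.1 hx f).abs
    rw [abs_zero] at h
    exact squeeze_zero (fun i => norm_nonneg _) (fun i => hf (x i)) h
  | zero =>
    simp only [inf_eq_right.2 (abs_nonneg _), norm_zero]
    exact tendsto_const_nhds
  | add s t hs ht ihs iht =>
    have hs0 := nonneg_of_mem_discreteCone hs
    have ht0 := nonneg_of_mem_discreteCone ht
    refine squeeze_zero (fun i => norm_nonneg _) (fun i => ?_) (by simpa using ihs.add iht)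
    exact (norm_le_norm_of_nonneg_of_le (le_inf (abs_nonneg _) (add_nonneg hs0 ht0))
      (inf_add_le_inf_add_inf (abs_nonneg _) hs0 ht0)).trans (norm_add_le _ _)

omit [IsOrderedModule ℝ E] in
/-- The ideal generated by the discrete elements is order dense, and hence norm dense when the
norm is order continuous: the elements `s` of its cone below `u` increase to `u`. -/
lemma exists_mem_discreteCone_norm_sub_lt (hE : IsDiscreteVectorLattice E)
    (hoc : HasOrderContinuousNorm E) {u : E} (hu : 0 ≤ u) {ε : ℝ} (hε : 0 < ε) :
    ∃ s ∈ discreteCone E, s ≤ u ∧ ‖u - s‖ < ε := by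
  let S : Type _ := {s : E // s ∈ discreteCone E ∧ s ≤ u}
  have : Nonempty S := ⟨⟨0, zero_mem _, hu⟩⟩
  have : IsDirectedOrder S := ⟨fun s t =>
    ⟨⟨s.1 ⊔ t.1, mem_discreteCone_of_le (add_mem s.2.1 t.2.1) _
      ((nonneg_of_mem_discreteCone s.2.1).trans le_sup_left)
      (sup_le (le_add_of_nonneg_right (nonneg_of_mem_discreteCone t.2.1))
        (le_add_of_nonneg_left (nonneg_of_mem_discreteCone s.2.1))),
      sup_le s.2.2 t.2.2⟩, le_sup_left (a := s.1), le_sup_right (a := s.1)⟩⟩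
  have hglb : IsGLB (Set.range fun s : S => u - s.1) 0 := by
    refine ⟨?_, fun v hv => ?_⟩
    · rintro _ ⟨s, rfl⟩
      exact sub_nonneg.2 s.2.2
    · by_contra hv0
      have hvpos : 0 < v⁺ := lt_of_le_of_ne (posPart_nonneg v) fun h =>
        hv0 (posPart_eq_zero.1 h.symm)
      obtain ⟨e, he, hev⟩ := hE _ hvpos
      have hvs : ∀ s : S, s.1 + e ≤ u := fun s => by
        rw [← le_sub_iff_add_le']
        exact hev.trans (sup_le (hv ⟨s, rfl⟩) (sub_nonneg.2 s.2.2))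
      -- all multiples of `e` lie below `u`, contrary to the Archimedean property
      have hne : ∀ n : ℕ, n • e ∈ discreteCone E ∧ n • e ≤ u := by
        intro n
        induction n with
        | zero => simpa using hu
        | succ n ih =>
          rw [succ_nsmul]
          exact ⟨add_mem ih.1 (AddSubmonoid.subset_closure he), hvs ⟨_, ih⟩⟩
      obtain ⟨n, hn⟩ := exists_nat_gt (‖u‖ / ‖e‖)
      have he0 : 0 < ‖e‖ := norm_pos_iff.2 he.1.ne'
      rw [div_lt_iff₀ he0] at hn
      have h := norm_le_norm_of_nonneg_of_le (nsmul_nonneg he.1.le n) (hne n).2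
      rw [← Nat.cast_smul_eq_nsmul ℝ, norm_smul, Real.norm_natCast] at h
      exact hn.not_ge h
  have hanti : Antitone fun s : S => u - s.1 := fun s t hst =>
    sub_le_sub_left (show s.1 ≤ t.1 from hst) u
  obtain ⟨s, hs⟩ := ((hoc S _ hanti hglb).eventually_lt_const hε).exists
  exact ⟨s.1, s.2.1, s.2.2, hs⟩

/-- Order intervals of a discrete Banach lattice with order continuous norm are norm compact; this
is the consequence of that fact for the truncations of a weakly null family. -/
lemma WeakTendsto.tendsto_norm_abs_inf (hE : IsDiscreteVectorLattice E)
    (hoc : HasOrderContinuousNorm E) {ι : Type*} {l : Filter ι} {x : ι → E}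
    (hx : WeakTendsto x l 0) {u : E} (hu : 0 ≤ u) :
    Tendsto (fun i => ‖|x i| ⊓ u‖) l (𝓝 0) := by
  refine tendsto_order.2 ⟨fun b hb => .of_forall fun i => hb.trans_le (norm_nonneg _), ?_⟩
  intro ε hε
  obtain ⟨s, hs, hsu, hus⟩ := exists_mem_discreteCone_norm_sub_lt hE hoc hu (half_pos hε)
  have h0 := nonneg_of_mem_discreteCone hs
  filter_upwards [(tendsto_norm_abs_inf_of_mem_discreteCone hx hs).eventually_lt_const
    (half_pos hε)] with i hi
  have hle : |x i| ⊓ u ≤ |x i| ⊓ s + (u - s) := by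
    calc |x i| ⊓ u = |x i| ⊓ (s + (u - s)) := by rw [add_sub_cancel]
      _ ≤ |x i| ⊓ s + |x i| ⊓ (u - s) :=
        inf_add_le_inf_add_inf (abs_nonneg _) h0 (sub_nonneg.2 hsu)
      _ ≤ _ := by gcongr; exact inf_le_right
  linarith [(norm_le_norm_of_nonneg_of_le (le_inf (abs_nonneg _) hu) hle).trans (norm_add_le _ _)]

end Discrete

/-! ### Disjoint sequences and truncation -/

section Truncation

variable {E F : Type*}
  [NormedAddCommGroup E] [NormedSpace ℝ E] [CompleteSpace E]
  [Lattice E] [IsOrderedAddMonoid E] [IsOrderedModule ℝ E] [HasSolidNorm E]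
  [NormedAddCommGroup F] [NormedSpace ℝ F]
  [Lattice F] [IsOrderedAddMonoid F] [HasSolidNorm F]

/-- Subtracting suitable multiples of the other terms makes a norm bounded positive sequence
disjoint. Here `S n` is the sum of the terms before `y n`, and `w` is `∑ 2⁻ⁱ yᵢ`. -/
lemma exists_disjoint_posPart_sub {y S : ℕ → E} {C : ℝ} (hy : ∀ n, 0 ≤ y n)
    (hC : ∀ n, ‖y n‖ ≤ C) (hS : ∀ n, S n = ∑ i ∈ Finset.range n, y i) :
    ∃ w : E, 0 ≤ w ∧ ∀ m n, m < n →
      (y m - (4 : ℝ) ^ m • S m - (2⁻¹ : ℝ) ^ m • w)⁺ ⊓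
        (y n - (4 : ℝ) ^ n • S n - (2⁻¹ : ℝ) ^ n • w)⁺ = 0 := by
  have hsum : Summable fun i => (2⁻¹ : ℝ) ^ i • y i := by
    refine Summable.of_norm_bounded
      ((summable_geometric_of_lt_one (r := (2⁻¹ : ℝ)) (by norm_num) (by norm_num)).mul_right C)
      fun i => ?_
    rw [norm_smul, Real.norm_of_nonneg (by positivity)]
    exact mul_le_mul_of_nonneg_left (hC i) (by positivity)
  have hterm : ∀ i, 0 ≤ (2⁻¹ : ℝ) ^ i • y i := fun i => smul_nonneg (by positivity) (hy i)
  have hS0 : ∀ n, 0 ≤ S n := fun n => hS n ▸ Finset.sum_nonneg fun i _ => hy i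
  have hw0 : 0 ≤ ∑' i, (2⁻¹ : ℝ) ^ i • y i := tsum_nonneg hterm
  refine ⟨∑' i, (2⁻¹ : ℝ) ^ i • y i, hw0, fun m n hmn => ?_⟩
  set w := ∑' i, (2⁻¹ : ℝ) ^ i • y i
  set d := y m - ((4 : ℝ) ^ n)⁻¹ • y n with hd
  have h4 : (0 : ℝ) < 4 ^ n := by positivity
  have h41 : ((4 : ℝ) ^ n)⁻¹ ≤ 1 := inv_le_one_of_one_le₀ (one_le_pow₀ (by norm_num))
  set a := (y m - (4 : ℝ) ^ m • S m - (2⁻¹ : ℝ) ^ m • w)⁺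
  set b := (y n - (4 : ℝ) ^ n • S n - (2⁻¹ : ℝ) ^ n • w)⁺
  -- the earlier term is at most `d⁺` because `4⁻ⁿ yₙ ≤ 2⁻ᵐ w`
  have ha : a ≤ d⁺ := by
    refine posPart_mono (sub_le_sub ?_ ?_)
    · exact sub_le_self _ (smul_nonneg (by positivity) (hS0 m))
    · have h1 : (2⁻¹ : ℝ) ^ n • y n ≤ w := hsum.le_tsum n fun i _ => hterm i
      have h2 : ((4 : ℝ) ^ n)⁻¹ ≤ (2⁻¹ : ℝ) ^ m * (2⁻¹ : ℝ) ^ n := by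
        calc ((4 : ℝ) ^ n)⁻¹ = (2⁻¹ : ℝ) ^ n * (2⁻¹ : ℝ) ^ n := by
              rw [← mul_pow, ← inv_pow]; norm_num
          _ ≤ _ := mul_le_mul_of_nonneg_right
              (pow_le_pow_of_le_one (by norm_num) (by norm_num) hmn.le) (by positivity)
      calc ((4 : ℝ) ^ n)⁻¹ • y n ≤ ((2⁻¹ : ℝ) ^ m * (2⁻¹ : ℝ) ^ n) • y n :=
            smul_le_smul_of_nonneg_right h2 (hy n)
        _ = (2⁻¹ : ℝ) ^ m • (2⁻¹ : ℝ) ^ n • y n := mul_smul _ _ _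
        _ ≤ (2⁻¹ : ℝ) ^ m • w := smul_le_smul_of_nonneg_left h1 (by positivity)
  -- the later term is at most `4ⁿ d⁻` because `yₘ` is a summand of `Sₙ`
  have hb : ((4 : ℝ) ^ n)⁻¹ • b ≤ d⁻ := by
    have hyS : y m ≤ S n := by
      rw [hS n]
      exact Finset.single_le_sum (fun i _ => hy i) (Finset.mem_range.2 hmn)
    have h1 : b ≤ (4 : ℝ) ^ n • d⁻ := by
      refine sup_le ?_ (smul_nonneg h4.le (negPart_nonneg d))
      calc y n - (4 : ℝ) ^ n • S n - (2⁻¹ : ℝ) ^ n • w ≤ y n - (4 : ℝ) ^ n • y m :=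
            (sub_le_self _ (smul_nonneg (by positivity) hw0)).trans
              (sub_le_sub_left (smul_le_smul_of_nonneg_left hyS h4.le) _)
        _ = (4 : ℝ) ^ n • (-d) := by
            rw [hd, neg_sub, smul_sub, smul_smul, mul_inv_cancel₀ h4.ne', one_smul]
        _ ≤ (4 : ℝ) ^ n • d⁻ := smul_le_smul_of_nonneg_left (neg_le_negPart d) h4.le
    simpa [smul_smul, h4.ne'] using smul_le_smul_of_nonneg_left h1 (inv_nonneg.2 h4.le)
  have hab0 : 0 ≤ a ⊓ b := le_inf (posPart_nonneg _) (posPart_nonneg _)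
  have hle : ((4 : ℝ) ^ n)⁻¹ • (a ⊓ b) ≤ 0 := by
    rw [← posPart_inf_negPart_eq_zero d]
    refine le_inf ?_ ((smul_le_smul_of_nonneg_left inf_le_right (inv_nonneg.2 h4.le)).trans hb)
    calc ((4 : ℝ) ^ n)⁻¹ • (a ⊓ b) ≤ (1 : ℝ) • (a ⊓ b) := smul_le_smul_of_nonneg_right h41 hab0
      _ = a ⊓ b := one_smul _ _
      _ ≤ d⁺ := inf_le_left.trans ha
  refine le_antisymm ?_ hab0
  simpa [smul_smul, h4.ne'] using smul_le_smul_of_nonneg_left hle h4.le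

/-- A positive uaw-Dunford–Pettis operator is small, uniformly along a norm bounded sequence, on
what lies above a suitable `u`. Otherwise there would be a norm bounded disjoint sequence on whose
image the norms do not tend to zero, while disjoint sequences are uaw-null. -/
lemma IsUawDunfordPettis.exists_norm_map_posPart_abs_sub_lt {T : E →L[ℝ] F}
    (hT : IsUawDunfordPettis T) (hpos : ∀ x : E, 0 ≤ x → 0 ≤ T x) {x : ℕ → E} {C : ℝ}
    (hx : ∀ n, ‖x n‖ ≤ C) {ε : ℝ} (hε : 0 < ε) :
    ∃ u : E, 0 ≤ u ∧ ∀ n, ‖T (|x n| - u)⁺‖ < ε := by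
  by_contra! H
  choose! k hk using H
  let S : ℕ → E := fun n => Nat.rec 0 (fun n s => s + |x (k ((4 : ℝ) ^ n • s))|) n
  let y : ℕ → E := fun n => |x (k ((4 : ℝ) ^ n • S n))|
  have hy : ∀ n, 0 ≤ y n := fun n => abs_nonneg _
  have hyC : ∀ n, ‖y n‖ ≤ C := fun n => (norm_abs_eq_norm _).trans_le (hx _)
  have hS : ∀ n, S n = ∑ i ∈ Finset.range n, y i := by
    intro n
    induction n with
    | zero => rfl
    | succ n ih => rw [Finset.sum_range_succ, ← ih]
  have hS0 : ∀ n, 0 ≤ S n := fun n => hS n ▸ Finset.sum_nonneg fun i _ => hy i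
  have hTy : ∀ n, ε ≤ ‖T (y n - (4 : ℝ) ^ n • S n)⁺‖ := fun n =>
    hk _ (smul_nonneg (by positivity) (hS0 n))
  obtain ⟨w, hw, hd⟩ := exists_disjoint_posPart_sub hy hyC hS
  have hbound : ∀ n, ‖(y n - (4 : ℝ) ^ n • S n - (2⁻¹ : ℝ) ^ n • w)⁺‖ ≤ C := fun n =>
    (norm_le_norm_of_nonneg_of_le (posPart_nonneg _) (sup_le
      ((sub_le_self _ (smul_nonneg (by positivity) hw)).trans
        (sub_le_self _ (smul_nonneg (by positivity) (hS0 n)))) (hy n))).trans (hyC n)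
  have hlim := (hT _ ⟨C, hbound⟩
    (uawTendsto_zero_of_pairwise_inf_eq_zero (fun n => posPart_nonneg _) hd)).add
    ((tendsto_pow_atTop_nhds_zero_of_lt_one (r := (2⁻¹ : ℝ)) (by norm_num) (by norm_num)).mul_const
      ‖T w‖)
  rw [zero_mul, add_zero] at hlim
  refine hε.not_ge (ge_of_tendsto' hlim fun n => (hTy n).trans ?_)
  set v := y n - (4 : ℝ) ^ n • S n
  have h2 : (0 : E) ≤ (2⁻¹ : ℝ) ^ n • w := smul_nonneg (by positivity) hw
  have hle : v⁺ ≤ (v - (2⁻¹ : ℝ) ^ n • w)⁺ + (2⁻¹ : ℝ) ^ n • w :=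
    sup_le (sub_le_iff_le_add.1 (le_posPart _)) (add_nonneg (posPart_nonneg _) h2)
  have hTle : T v⁺ ≤ T (v - (2⁻¹ : ℝ) ^ n • w)⁺ + (2⁻¹ : ℝ) ^ n • T w := by
    rw [← map_smul, ← map_add, ← sub_nonneg, ← map_sub]
    exact hpos _ (sub_nonneg.2 hle)
  refine (norm_le_norm_of_nonneg_of_le (hpos _ (posPart_nonneg _)) hTle).trans
    ((norm_add_le _ _).trans ?_)
  rw [norm_smul, Real.norm_of_nonneg (by positivity : (0 : ℝ) ≤ 2⁻¹ ^ n)]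

end Truncation

/-- The reason is that `|T x| ≤ T |x| ≤ T u + T (|x| - u)⁺`. -/
lemma abs_map_le_inf_add {E F : Type*}
    [NormedAddCommGroup E] [NormedSpace ℝ E] [Lattice E] [IsOrderedAddMonoid E]
    [NormedAddCommGroup F] [NormedSpace ℝ F] [Lattice F] [IsOrderedAddMonoid F]
    {T : E →L[ℝ] F} (hpos : ∀ x : E, 0 ≤ x → 0 ≤ T x) (x : E) {u : E} (hu : 0 ≤ u) :
    |T x| ≤ |T x| ⊓ T u + T (|x| - u)⁺ := by
  have hmono : ∀ a b : E, a ≤ b → T a ≤ T b := fun a b hab => by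
    rw [← sub_nonneg, ← map_sub]
    exact hpos _ (sub_nonneg.2 hab)
  have hr : 0 ≤ T (|x| - u)⁺ := hpos _ (posPart_nonneg _)
  have habs : |T x| ≤ T |x| :=
    sup_le (hmono _ _ (le_abs_self x)) (by rw [← map_neg]; exact hmono _ _ (neg_le_abs x))
  have hsplit : T |x| ≤ T u + T (|x| - u)⁺ := by
    rw [← map_add]
    exact hmono _ _ (sub_le_iff_le_add'.1 (le_posPart _))
  calc |T x| = |T x| ⊓ (T u + T (|x| - u)⁺) := (inf_eq_left.2 (habs.trans hsplit)).symm
    _ ≤ |T x| ⊓ T u + |T x| ⊓ T (|x| - u)⁺ := inf_add_le_inf_add_inf (abs_nonneg _) (hpos u hu) hr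
    _ ≤ _ := by gcongr; exact inf_le_right

/-! ### Weakly null sequences under uaw-Dunford–Pettis operators -/

theorem theorem3p5 {E F : Type*}
    [NormedAddCommGroup E] [NormedSpace ℝ E] [CompleteSpace E]
    [Lattice E] [IsOrderedAddMonoid E] [IsOrderedModule ℝ E] [HasSolidNorm E]
    [NormedAddCommGroup F] [NormedSpace ℝ F] [CompleteSpace F]
    [Lattice F] [IsOrderedAddMonoid F] [IsOrderedModule ℝ F] [HasSolidNorm F]
    (T : E →L[ℝ] F) (hT : IsUawDunfordPettis T)
    (h : WeaklySeqContinuousLatticeOps E ∨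
      (IsDiscreteVectorLattice E ∧ HasOrderContinuousNorm E) ∨
      ((∀ x : E, 0 ≤ x → 0 ≤ T x) ∧ IsDiscreteVectorLattice F ∧ HasOrderContinuousNorm F)) :
    IsDunfordPettis T := by
  intro x hx
  obtain ⟨C, hC⟩ := hx.exists_norm_le
  rcases h with hops | ⟨hE, hoc⟩ | ⟨hpos, hF, hoc⟩
  · refine hT x ⟨C, hC⟩ fun u hu => ?_
    simp only [sub_zero]
    exact (hops x hx).of_nonneg_of_le (fun n => le_inf (abs_nonneg _) hu) fun n => inf_le_left
  · refine hT x ⟨C, hC⟩ fun u hu => ?_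
    simp only [sub_zero]
    exact weakTendsto_zero_of_tendsto_norm (hx.tendsto_norm_abs_inf hE hoc hu)
  · refine tendsto_order.2 ⟨fun b hb => .of_forall fun n => hb.trans_le (norm_nonneg _), ?_⟩
    intro ε hε
    obtain ⟨u, hu, hur⟩ := hT.exists_norm_map_posPart_abs_sub_lt hpos hC (half_pos hε)
    have hTx : WeakTendsto (fun n => T (x n)) atTop 0 := by simpa using hx.map T
    filter_upwards [(hTx.tendsto_norm_abs_inf hF hoc (hpos u hu)).eventually_lt_const
      (half_pos hε)] with n hn
    have hle := (norm_le_norm_of_nonneg_of_le (abs_nonneg _)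
      (abs_map_le_inf_add hpos (x n) hu)).trans (norm_add_le _ _)
    rw [norm_abs_eq_norm] at hle
    linarith [hur n]
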